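/- Let $D\subset\mathbb R^d$ be a bounded open set (the one-dimensional case $D\subset\mathbb R$ is included), let $T>0$, and let $\langle\cdot,\cdot\rangle$ be the scalar product of the real Hilbert space $L^2(D)$. Let $\mathcal L:D(\mathcal L)\subset L^2(D)\to L^2(D)$ be a densely defined, self-adjoint, positive linear operator with compact inverse, and let $(e_j)_{j\in\mathbb N}$ be an orthonormal basis of $L^2(D)$ with $e_j\in D(\mathcal L)$ and $\mathcal L e_j=\lambda_j e_j$. Let $Q$ be a bounded, self-adjoint, positive semidefinite operator on $L^2(D)$ with $Qe_j=\mu_je_j$ for all $j$ and $\operatorname{Tr}Q<\infty$, and let $W$ be an $L^2(D)$-valued $Q$-Wiener process on $[0,T]$ over a probability space $(\Omega,\mathcal F,\mathbb P)$. Put $B_j(t)=\mu_j^{-1/2}\langle W(t),e_j\rangle$ if $\mu_j>0$ and $B_j=0$ if $\mu_j=0$, so that $W(t)=\sum_j\sqrt{\mu_j}\,B_j(t)\,e_j$. Let $y_0\in L^2(D)$ be deterministic. For $s>0$ let $y(s)=\sum_j y_j(s,\cdot)e_j$ be the solution of $dy+\mathcal L^s y\,dt=dW$, $y(0)=y_0$;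 that is, $t\mapsto y_j(s,t)$ is the continuous solution on $[0,T]$ of the Itô equation $$dy_j=-\lambda_j^s\,y_j\,dt+\sqrt{\mu_j}\,dB_j,\qquad y_j(s,0)=\langle y_0,e_j\rangle .$$ Since the noise is additive, this equation is understood path by path, simultaneously for all $s>0$ on one event of full probability. Then, almost surely, for all $j$ and all $t\in[0,T]$ the function $s\mapsto y_j(s,t)$ is twice continuously differentiable on $(0,\infty)$, and for every $\bar s\in(0,\infty)$ the following holds. 1. The series $$\partial_s y(\bar s)=\sum_{j}\partial_s y_j(\bar s,\cdot)\,e_j\qquad\text{and}\qquad \partial_{ss}^2y(\bar s)=\sum_{j}\partial_{ss}^2y_j(\bar s,\cdot)\,e_j$$ converge in $L^2(\Omega,L^2(D\times[0,T]))$; in particular their sums belong to this space. 2. Almost surely, both series also converge in $L^2(D\times[0,T])$, to the values at $\omega$ of the sums in 1, and for $k=1,2$ $$\|\partial_s^k y(\bar s,\omega)\|^2_{L^2(D\times[0,T])}=\sum_j\int_0^T|\partial_s^k y_j(\bar s,t,\omega)|^2\,dt<\infty .$$ -/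

import Mathlib

open MeasureTheory ProbabilityTheory Filter Topology Set
open scoped ENNReal NNReal RealInnerProductSpace

noncomputable section

namespace FractionalSPDE

section Hilbert

variable {H : Type*} [NormedAddCommGroup H] [InnerProductSpace ℝ H] [CompleteSpace H]

/-- `L : D(L) ⊆ H → H` is densely defined, self-adjoint, positive and has a compact inverse `K`
(everywhere defined on `H`). -/
structure IsDiffusionOperator (L : H →ₗ.[ℝ] H) : Prop where
  dense_domain : Dense (L.domain : Set H)
  selfAdjoint : IsSelfAdjoint L
  positive : ∀ v : L.domain, v ≠ 0 → 0 < ⟪L v, (v : H)⟫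
  compact_inverse : ∃ K : H →L[ℝ] H, IsCompactOperator K ∧
    (∀ v : L.domain, K (L v) = v) ∧
    ∀ w : H, ∃ h : K w ∈ L.domain, L ⟨K w, h⟩ = w

/-- The orthonormal basis `e` consists of eigenvectors of `L`, with eigenvalues `lam`. -/
def IsEigenbasis (L : H →ₗ.[ℝ] H) (e : HilbertBasis ℕ ℝ H) (lam : ℕ → ℝ) : Prop :=
  ∀ j, ∃ h : e j ∈ L.domain, L ⟨e j, h⟩ = lam j • e j

/-- `Q` is a covariance operator which is diagonal in the basis `e`, with eigenvalues `mu`: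
bounded, self-adjoint, positive semidefinite and of finite trace. -/
structure IsCovariance (Q : H →L[ℝ] H) (e : HilbertBasis ℕ ℝ H) (mu : ℕ → ℝ) : Prop where
  isPositive : Q.IsPositive
  eigen : ∀ j, Q (e j) = mu j • e j
  finite_trace : Summable fun j => ⟪Q (e j), e j⟫

/-- `W` is an `H`-valued `Q`-Wiener process on `[0, T]` under `P`: it starts at `0`, has continuous
paths, independent increments, and `W t - W s` is centred Gaussian with covariance
`(t - s) Q`. -/
structure IsQWiener {Ω : Type*} [MeasurableSpace Ω] (P : Measure Ω) (T : ℝ) (Q : H →L[ℝ] H)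
    (W : Icc (0 : ℝ) T → Ω → H) : Prop where
  stronglyMeasurable : ∀ t, StronglyMeasurable (W t)
  zero : ∀ t : Icc (0 : ℝ) T, (t : ℝ) = 0 → ∀ᵐ ω ∂P, W t ω = 0
  continuous_paths : ∀ᵐ ω ∂P, Continuous fun t => W t ω
  indep_increments : letI : MeasurableSpace H := borel H; HasIndepIncrements W P
  gaussian_increments : ∀ s t : Icc (0 : ℝ) T, s ≤ t → ∀ h : H,
    P.map (fun ω => ⟪W t ω - W s ω, h⟫) =
      gaussianReal 0 (Real.toNNReal (((t : ℝ) - s) * ⟪Q h, h⟫))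

/-- The real Brownian motions `B_j(t) = ⟨W(t), e_j⟩ / √μ_j` of the expansion
`W(t) = ∑_j √μ_j B_j(t) e_j`. If `μ_j = 0`, then `⟨W(t), e_j⟩ = 0` almost surely, `B_j` is set to
zero, and it enters everything below only through the product `√μ_j B_j`. -/
def modeBM {Ω : Type*} {T : ℝ} (e : HilbertBasis ℕ ℝ H) (mu : ℕ → ℝ)
    (W : Icc (0 : ℝ) T → Ω → H) (j : ℕ) (t : Icc (0 : ℝ) T) (ω : Ω) : ℝ :=
  ⟪W t ω, e j⟫ / √(mu j)

/-- `y j s t ω` is the family of modes `y_j(s, t) = ⟨y(s)(t), e_j⟩` of the solution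
`y(s) = ∑_j y_j(s, ·) e_j` of `dy + L^s y dt = dW`, `y(0) = y₀`. For every exponent `s > 0` and every
`j`, the process `t ↦ y j s t` is continuous on `[0, T]` and solves the Itô equation
`dy_j = - λ_j^s y_j dt + √μ_j dB_j`, `y_j(0) = ⟨y₀, e_j⟩`.

The noise is additive, so the integrated equation makes sense, and is uniquely solvable, path by
path. The solutions for different `s` are taken on one common event of full probability, so that
`s ↦ y j s t ω` may be differentiated. -/
def IsModeSolution {Ω : Type*} [MeasurableSpace Ω] (P : Measure Ω) (T : ℝ)
    (e : HilbertBasis ℕ ℝ H) (lam mu : ℕ → ℝ) (W : Icc (0 : ℝ) T → Ω → H) (y₀ : H)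
    (y : ℕ → ℝ → ℝ → Ω → ℝ) : Prop :=
  ∀ᵐ ω ∂P, ∀ j, ∀ s : ℝ, 0 < s →
    ContinuousOn (fun t => y j s t ω) (Icc 0 T) ∧
    ∀ t : Icc (0 : ℝ) T,
      y j s t ω = ⟪y₀, e j⟫ - (∫ τ in (0 : ℝ)..t, lam j ^ s * y j s τ ω)
        + √(mu j) * modeBM e mu W j t ω

end Hilbert

section Space

variable {E : Type*} [NormedAddCommGroup E] [InnerProductSpace ℝ E] [FiniteDimensional ℝ E]
  [MeasurableSpace E] [BorelSpace E]

/-- The real Hilbert space `L²(D)`. -/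
abbrev L2D (D : Set E) : Type _ := Lp ℝ 2 (volume.restrict D)

/-- Lebesgue measure on `D × [0, T]`. -/
def cylMeasure (D : Set E) (T : ℝ) : Measure (E × ℝ) :=
  (volume.restrict D).prod (volume.restrict (Icc (0 : ℝ) T))

/-- The real Hilbert space `L²(D × [0, T])`. -/
abbrev L2DT (D : Set E) (T : ℝ) : Type _ := Lp ℝ 2 (cylMeasure D T)

/-- The `k`-th derivative `∂_s^k y_j(s, t)` of a mode with respect to the exponent. -/
def modeDeriv {Ω : Type*} (y : ℕ → ℝ → ℝ → Ω → ℝ) (k j : ℕ) (s t : ℝ) (ω : Ω) : ℝ :=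
  iteratedDeriv k (fun r => y j r t ω) s

end Space

end FractionalSPDE

end

noncomputable section

namespace FractionalSPDE

/-! Write `a = l ^ s`, `c` for the initial coefficient and `g` for the noise of one mode.
Integration by parts removes the stochastic integral: `y(t) = (c + g(t)) e^{-at} - ∫₀ᵗ a e^{-a(t-τ)}
(g(τ) - g(t)) dτ` (`eq_of_linear_integral_equation`). For a fixed continuous path this is smooth in
`s`. Each `∂_s` acts as `log l` times `x d/dx` in the variable `x = a r`, so it only produces a
power of `log l` and a polynomial in `x` (`hasDerivAt_modeRep`).

The polynomials cost half of the exponential decay (`modeRep_sq_le`). Centring the integrand at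
`g(t)` is decisive: `E|g(τ) - g(t)|² ≤ m (t - τ)`, and `∫ a e^{-ar/2} r dr` is of order `1/a`. Hence
the expected squared `L²(0,T)` norm of the `k`-th derivative is at most a constant times `(log
l)^{2k} l^{-s} (c² + 17 m T)` (`lintegral_lintegral_modeRep_sq_le`). The eigenvalues stay away from
zero, so `(log l)^{2k} l^{-s}` is bounded uniformly over the modes (`exists_log_pow_div_rpow_le`).
The remaining factors are summable by Bessel's inequality for `y₀` and the finite trace of `Q`.

For every path the terms of the series are orthogonal in `L²(D × [0,T])`, because the `e j` are.
Summable squared norms therefore give convergence in `L²(Ω, L²(D × [0,T]))` and almost surely, with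
the same sum (`exists_hasSum_Lp_of_orthogonal`). -/

/-- The polynomial factors of `θᵏ (e^{-x})`, where `θ = x d/dx` and `k ≤ 2`. -/
def decayPoly : ℕ → ℝ → ℝ
  | 0, _ => 1
  | 1, x => -x
  | _, x => -x + x ^ 2

/-- The polynomial factors of `θᵏ (x e^{-x}) / x`, where `θ = x d/dx` and `k ≤ 2`. -/
def kernelPoly : ℕ → ℝ → ℝ
  | 0, _ => 1
  | 1, x => 1 - x
  | _, x => 1 - 3 * x + x ^ 2

/-- The `k`-th derivative with respect to `s` of `e^{-l ^ s t}`, up to the factor `(log l) ^ k`. -/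
def decay (l : ℝ) (k : ℕ) (s t : ℝ) : ℝ :=
  decayPoly k (l ^ s * t) * Real.exp (-(l ^ s * t))

/-- The `k`-th derivative with respect to `s` of `l ^ s e^{-l ^ s r}`, up to the factor
`(log l) ^ k`. -/
def kernel (l : ℝ) (k : ℕ) (s r : ℝ) : ℝ :=
  l ^ s * kernelPoly k (l ^ s * r) * Real.exp (-(l ^ s * r))

/-- The `k`-th derivative with respect to `s` of the solution at time `t` of
`y(t) = c - l ^ s ∫₀ᵗ y + g(t)`, represented without stochastic integrals. -/
def modeRep (l c : ℝ) (g : ℝ → ℝ) (k : ℕ) (s t : ℝ) : ℝ :=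
  Real.log l ^ k * ((c + g t) * decay l k s t - ∫ τ in (0 : ℝ)..t, kernel l k s (t - τ) * (g τ - g t))

/-! ### Regularity of the representation in the exponent -/

lemma continuous_decayPoly (k : ℕ) : Continuous (decayPoly k) := by
  match k with
  | 0 => exact continuous_const
  | 1 => exact continuous_neg
  | (n + 2) => show Continuous fun x : ℝ => -x + x ^ 2; fun_prop

lemma continuous_kernelPoly (k : ℕ) : Continuous (kernelPoly k) := by
  match k with
  | 0 => exact continuous_const
  | 1 => show Continuous fun x : ℝ => 1 - x; fun_prop
  | (n + 2) => show Continuous fun x : ℝ => 1 - 3 * x + x ^ 2; fun_prop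

lemma continuous_decay {l : ℝ} (hl : 0 < l) (k : ℕ) :
    Continuous fun p : ℝ × ℝ => decay l k p.1 p.2 := by
  have h : Continuous fun p : ℝ × ℝ => l ^ p.1 * p.2 :=
    (continuous_const.rpow continuous_fst fun _ => Or.inl hl.ne').mul continuous_snd
  exact ((continuous_decayPoly k).comp h).mul (Real.continuous_exp.comp h.neg)

lemma continuous_kernel {l : ℝ} (hl : 0 < l) (k : ℕ) :
    Continuous fun p : ℝ × ℝ => kernel l k p.1 p.2 := by
  have h0 : Continuous fun p : ℝ × ℝ => l ^ p.1 :=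
    continuous_const.rpow continuous_fst fun _ => Or.inl hl.ne'
  have h : Continuous fun p : ℝ × ℝ => l ^ p.1 * p.2 := h0.mul continuous_snd
  exact (h0.mul ((continuous_kernelPoly k).comp h)).mul (Real.continuous_exp.comp h.neg)

lemma hasDerivAt_rpow_exponent {l : ℝ} (hl : 0 < l) (s : ℝ) :
    HasDerivAt (fun s : ℝ => l ^ s) (Real.log l * l ^ s) s := by
  simpa [mul_comm] using (hasDerivAt_id s).const_rpow hl

lemma hasDerivAt_decay {l : ℝ} (hl : 0 < l) {k : ℕ} (hk : k < 2) (s t : ℝ) :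
    HasDerivAt (fun s => decay l k s t) (Real.log l * decay l (k + 1) s t) s := by
  have h := (hasDerivAt_rpow_exponent hl s).mul_const t
  have he := h.neg.exp
  interval_cases k
  · simp only [decay, decayPoly]
    exact (he.const_mul 1).congr_deriv (by simp only [Pi.neg_apply]; ring)
  · simp only [decay, decayPoly]
    exact (h.neg.mul he).congr_deriv (by simp only [Pi.neg_apply]; ring)

lemma hasDerivAt_kernel {l : ℝ} (hl : 0 < l) {k : ℕ} (hk : k < 2) (s r : ℝ) :
    HasDerivAt (fun s => kernel l k s r) (Real.log l * kernel l (k + 1) s r) s := by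
  have h0 := hasDerivAt_rpow_exponent hl s
  have h := h0.mul_const r
  have he := h.neg.exp
  interval_cases k
  · simp only [kernel, kernelPoly]
    exact ((h0.mul_const 1).mul he).congr_deriv (by simp only [Pi.neg_apply]; ring)
  · simp only [kernel, kernelPoly]
    exact ((h0.mul (h.const_sub 1)).mul he).congr_deriv
      (by simp only [Pi.neg_apply, Pi.mul_apply]; ring)

/-- Differentiation under the integral sign over a compact interval. -/
lemma hasDerivAt_intervalIntegral_of_continuous {F F' : ℝ → ℝ → ℝ}
    (hF : ∀ s, Continuous (F s)) (hF' : Continuous F'.uncurry)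
    (hd : ∀ s τ, HasDerivAt (fun s => F s τ) (F' s τ) s) (a b s : ℝ) :
    HasDerivAt (fun s => ∫ τ in a..b, F s τ) (∫ τ in a..b, F' s τ) s := by
  obtain ⟨C, hC⟩ := ((isCompact_closedBall s 1).prod (isCompact_uIcc (a := a) (b := b))).bddAbove_image
    hF'.norm.continuousOn
  refine (intervalIntegral.hasDerivAt_integral_of_dominated_loc_of_deriv_le
    (bound := fun _ => C) (Metric.closedBall_mem_nhds s one_pos)
    (Eventually.of_forall fun x => (hF x).aestronglyMeasurable) ((hF s).intervalIntegrable _ _)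
    (hF'.uncurry_left s).aestronglyMeasurable (Eventually.of_forall fun τ hτ x hx => ?_)
    intervalIntegrable_const (Eventually.of_forall fun τ _ x _ => hd x τ)).2
  exact hC ⟨(x, τ), ⟨hx, uIoc_subset_uIcc hτ⟩, rfl⟩

lemma continuous_kernel_mul {l : ℝ} (hl : 0 < l) {g : ℝ → ℝ} (hg : Continuous g) (k : ℕ) (t : ℝ) :
    Continuous (fun s τ => kernel l k s (t - τ) * (g τ - g t)).uncurry := by
  have : Continuous fun p : ℝ × ℝ => (p.1, t - p.2) := by fun_prop
  exact ((continuous_kernel hl k).comp this).mul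
    ((hg.comp continuous_snd).sub continuous_const)

lemma hasDerivAt_modeRep {l : ℝ} (hl : 0 < l) (c : ℝ) {g : ℝ → ℝ} (hg : Continuous g)
    {k : ℕ} (hk : k < 2) (s t : ℝ) :
    HasDerivAt (fun s => modeRep l c g k s t) (modeRep l c g (k + 1) s t) s := by
  have h1 := (hasDerivAt_decay hl hk s t).const_mul (c + g t)
  have h2 : HasDerivAt (fun s => ∫ τ in (0 : ℝ)..t, kernel l k s (t - τ) * (g τ - g t))
      (∫ τ in (0 : ℝ)..t, Real.log l * (kernel l (k + 1) s (t - τ) * (g τ - g t))) s := by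
    refine hasDerivAt_intervalIntegral_of_continuous
      (F := fun s τ => kernel l k s (t - τ) * (g τ - g t))
      (F' := fun s τ => Real.log l * (kernel l (k + 1) s (t - τ) * (g τ - g t)))
      (fun s => (continuous_kernel_mul hl hg k t).uncurry_left s)
      (continuous_const.mul (continuous_kernel_mul hl hg (k + 1) t)) (fun s τ => ?_) 0 t s
    rw [← mul_assoc]
    exact (hasDerivAt_kernel hl hk s (t - τ)).mul_const _
  rw [intervalIntegral.integral_const_mul] at h2
  exact ((h1.sub h2).const_mul (Real.log l ^ k)).congr_deriv (by simp only [modeRep]; ring)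

lemma continuous_modeRep_exponent {l : ℝ} (hl : 0 < l) (c : ℝ) {g : ℝ → ℝ} (hg : Continuous g)
    (k : ℕ) (t : ℝ) : Continuous fun s => modeRep l c g k s t := by
  have h1 : Continuous fun s => decay l k s t :=
    (continuous_decay hl k).comp (continuous_id.prodMk continuous_const)
  exact continuous_const.mul ((continuous_const.mul h1).sub
    (intervalIntegral.continuous_parametric_intervalIntegral_of_continuous'
      (continuous_kernel_mul hl hg k t) 0 t))

lemma deriv_modeRep {l : ℝ} (hl : 0 < l) (c : ℝ) {g : ℝ → ℝ} (hg : Continuous g)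
    {k : ℕ} (hk : k < 2) (t : ℝ) :
    deriv (fun s => modeRep l c g k s t) = fun s => modeRep l c g (k + 1) s t :=
  funext fun s => (hasDerivAt_modeRep hl c hg hk s t).deriv

lemma contDiff_modeRep {l : ℝ} (hl : 0 < l) (c : ℝ) {g : ℝ → ℝ} (hg : Continuous g) (t : ℝ) :
    ContDiff ℝ 2 fun s => modeRep l c g 0 s t := by
  have h1 : ContDiff ℝ 1 fun s => modeRep l c g 1 s t := by
    rw [contDiff_one_iff_deriv, deriv_modeRep hl c hg one_lt_two]
    exact ⟨fun s => (hasDerivAt_modeRep hl c hg one_lt_two s t).differentiableAt,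
      continuous_modeRep_exponent hl c hg 2 t⟩
  rw [show (2 : WithTop ℕ∞) = 1 + 1 from one_add_one_eq_two.symm, contDiff_succ_iff_deriv,
    deriv_modeRep hl c hg two_pos]
  -- The middle component concerns only the analytic order `ω`, which `1` is not.
  exact ⟨fun s => (hasDerivAt_modeRep hl c hg two_pos s t).differentiableAt,
    fun h => by simp at h, h1⟩

lemma iteratedDeriv_modeRep {l : ℝ} (hl : 0 < l) (c : ℝ) {g : ℝ → ℝ} (hg : Continuous g)
    {k : ℕ} (hk : k ≤ 2) (t : ℝ) :
    iteratedDeriv k (fun s => modeRep l c g 0 s t) = fun s => modeRep l c g k s t := by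
  induction k with
  | zero => exact iteratedDeriv_zero
  | succ k ih => rw [iteratedDeriv_succ, ih (by omega), deriv_modeRep hl c hg (by omega)]

/-! ### Pathwise solution formula -/

/-- The integrand is the derivative of `e^{-a(t-τ)}` in `τ`. This mass is what allows recentring the
noise at `g t` in the solution formula, and it bounds the kernels uniformly in `a`. -/
lemma integral_exp_kernel (a t : ℝ) :
    ∫ τ in (0 : ℝ)..t, a * Real.exp (-(a * (t - τ))) = 1 - Real.exp (-(a * t)) := by
  have h : ∀ τ ∈ uIcc 0 t, HasDerivAt (fun τ => Real.exp (-(a * (t - τ))))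
      (a * Real.exp (-(a * (t - τ)))) τ := fun τ _ => by
    exact ((((hasDerivAt_id' τ).const_sub t).const_mul a).fun_neg.exp).congr_deriv (by ring)
  rw [intervalIntegral.integral_eq_sub_of_hasDerivAt h
    (Continuous.intervalIntegrable (by fun_prop) _ _)]
  simp

/-- The continuous solution of the linear integral equation `y(t) = c - a ∫₀ᵗ y + g(t)`. -/
lemma eq_of_linear_integral_equation {T a c : ℝ} {y g : ℝ → ℝ} (hg : Continuous g)
    (hy : ContinuousOn y (Icc 0 T))
    (h : ∀ t ∈ Icc (0 : ℝ) T, y t = c - (∫ τ in (0 : ℝ)..t, a * y τ) + g t)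
    {t : ℝ} (ht : t ∈ Icc (0 : ℝ) T) :
    y t = (c + g t) * Real.exp (-(a * t))
      - ∫ τ in (0 : ℝ)..t, a * Real.exp (-(a * (t - τ))) * (g τ - g t) := by
  have hT : (0 : ℝ) ≤ T := ht.1.trans ht.2
  -- The path is continuous on `[0, T]` only; the extension by constants has a primitive that is
  -- differentiable everywhere, endpoints included.
  set z : ℝ → ℝ := IccExtend hT (domRestrict (Icc 0 T) y) with hz
  have hzc : Continuous z := (continuousOn_iff_continuous_domRestrict.1 hy).Icc_extend'
  have hzy : ∀ t ∈ Icc (0 : ℝ) T, z t = y t := fun t ht => IccExtend_of_mem hT _ ht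
  set Y : ℝ → ℝ := fun t => ∫ τ in (0 : ℝ)..t, z τ with hY
  have hYd : ∀ t, HasDerivAt Y (z t) t := fun t =>
    (hzc.integral_hasStrictDerivAt 0 t).hasDerivAt
  have heq : ∀ t ∈ Icc (0 : ℝ) T, y t = c - a * Y t + g t := by
    intro t ht
    rw [h t ht, intervalIntegral.integral_const_mul]
    congr 3
    refine intervalIntegral.integral_congr fun τ hτ => ?_
    rw [uIcc_of_le ht.1] at hτ
    exact (hzy τ ⟨hτ.1, hτ.2.trans ht.2⟩).symm
  -- Integrating factor for `Y' = c - a Y + g`.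
  have hYt : Real.exp (a * t) * Y t = ∫ τ in (0 : ℝ)..t, Real.exp (a * τ) * (c + g τ) := by
    have hd : ∀ x ∈ uIcc 0 t, HasDerivAt (fun x => Real.exp (a * x) * Y x)
        (Real.exp (a * x) * (c + g x)) x := by
      intro x hx
      rw [uIcc_of_le ht.1] at hx
      have hx' : x ∈ Icc 0 T := ⟨hx.1, hx.2.trans ht.2⟩
      refine ((((hasDerivAt_id' x).const_mul a).exp).fun_mul (hYd x)).congr_deriv ?_
      rw [hzy x hx', heq x hx']
      ring
    rw [intervalIntegral.integral_eq_sub_of_hasDerivAt hd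
      (Continuous.intervalIntegrable (by fun_prop) _ _)]
    simp [hY]
  -- Subtracting `c + g t` times the mass of the kernel from the variation of constants formula
  -- replaces `c + g τ` by `g τ - g t`.
  have key : (∫ τ in (0 : ℝ)..t, a * Real.exp (-(a * (t - τ))) * (g τ - g t))
      = a * Y t - (c + g t) * (1 - Real.exp (-(a * t))) := by
    have hYt' : a * Y t = ∫ τ in (0 : ℝ)..t, a * Real.exp (-(a * (t - τ))) * (c + g τ) := by
      have : Y t = Real.exp (-(a * t)) * (Real.exp (a * t) * Y t) := by
        rw [← mul_assoc, ← Real.exp_add]; simp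
      rw [this, hYt, ← intervalIntegral.integral_const_mul, ← intervalIntegral.integral_const_mul]
      refine intervalIntegral.integral_congr fun τ _ => ?_
      rw [show -(a * (t - τ)) = -(a * t) + a * τ by ring, Real.exp_add]
      ring
    rw [hYt', ← integral_exp_kernel, ← intervalIntegral.integral_const_mul,
      ← intervalIntegral.integral_sub (Continuous.intervalIntegrable (by fun_prop) _ _)
        (Continuous.intervalIntegrable (by fun_prop) _ _)]
    refine intervalIntegral.integral_congr fun τ _ => ?_
    ring
  rw [key, heq t ht]
  ring

lemma eq_modeRep_of_linear_integral_equation {T l s c : ℝ} {y g : ℝ → ℝ} (hg : Continuous g)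
    (hy : ContinuousOn y (Icc 0 T))
    (h : ∀ t ∈ Icc (0 : ℝ) T, y t = c - (∫ τ in (0 : ℝ)..t, l ^ s * y τ) + g t)
    {t : ℝ} (ht : t ∈ Icc (0 : ℝ) T) : y t = modeRep l c g 0 s t := by
  rw [eq_of_linear_integral_equation hg hy h ht]
  simp [modeRep, decay, kernel, decayPoly, kernelPoly]

/-! ### Pathwise bounds -/

/-- Eight times the quadratic Taylor polynomial of `exp` at `x / 2` is `8 + 4x + x²`. The left side
is a common majorant of all the factors `decayPoly` and `kernelPoly`, so half of the decay pays for
any of them. -/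
lemma polynomial_le_exp_half {x : ℝ} (hx : 0 ≤ x) :
    1 + 3 * x + x ^ 2 ≤ 8 * Real.exp (x / 2) := by
  have := Real.quadratic_le_exp_of_nonneg (by positivity : 0 ≤ x / 2)
  nlinarith

lemma abs_decayPoly_le (k : ℕ) {x : ℝ} (hx : 0 ≤ x) : |decayPoly k x| ≤ 1 + 3 * x + x ^ 2 := by
  match k with
  | 0 => simp only [decayPoly, abs_one]; nlinarith
  | 1 => rw [abs_le]; simp only [decayPoly]; constructor <;> nlinarith
  | (n + 2) => rw [abs_le]; simp only [decayPoly]; constructor <;> nlinarith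

lemma abs_kernelPoly_le (k : ℕ) {x : ℝ} (hx : 0 ≤ x) : |kernelPoly k x| ≤ 1 + 3 * x + x ^ 2 := by
  match k with
  | 0 => simp only [kernelPoly, abs_one]; nlinarith
  | 1 => rw [abs_le]; simp only [kernelPoly]; constructor <;> nlinarith
  | (n + 2) => rw [abs_le]; simp only [kernelPoly]; constructor <;> nlinarith

lemma mul_exp_neg_le {p x : ℝ} (hx : 0 ≤ x) (hp : p ≤ 1 + 3 * x + x ^ 2) :
    p * Real.exp (-x) ≤ 8 * Real.exp (-(x / 2)) := by
  calc p * Real.exp (-x) ≤ 8 * Real.exp (x / 2) * Real.exp (-x) := by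
        gcongr; exact hp.trans (polynomial_le_exp_half hx)
    _ = 8 * Real.exp (-(x / 2)) := by
        rw [mul_assoc, ← Real.exp_add]; congr 2; ring

lemma abs_decay_le {l s t : ℝ} (hl : 0 < l) (ht : 0 ≤ t) (k : ℕ) :
    |decay l k s t| ≤ 8 * Real.exp (-(l ^ s * t / 2)) := by
  have hx : 0 ≤ l ^ s * t := by positivity
  rw [decay, abs_mul, Real.abs_exp]
  exact mul_exp_neg_le hx (abs_decayPoly_le k hx)

lemma abs_kernel_le {l s r : ℝ} (hl : 0 < l) (hr : 0 ≤ r) (k : ℕ) :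
    |kernel l k s r| ≤ 8 * (l ^ s * Real.exp (-(l ^ s * r / 2))) := by
  have hx : 0 ≤ l ^ s * r := by positivity
  have ha : 0 < l ^ s := Real.rpow_pos_of_pos hl s
  rw [kernel, abs_mul, abs_mul, Real.abs_exp, abs_of_pos ha, mul_assoc]
  calc _ ≤ l ^ s * (8 * Real.exp (-(l ^ s * r / 2))) :=
        mul_le_mul_of_nonneg_left (mul_exp_neg_le hx (abs_kernelPoly_le k hx)) ha.le
    _ = _ := by ring

/-- The integrand is twice the exponential kernel of rate `a / 2`, whose mass is below one. -/
lemma integral_exp_half_kernel_le {a t : ℝ} :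
    ∫ τ in (0 : ℝ)..t, a * Real.exp (-(a * (t - τ) / 2)) ≤ 2 := by
  have h := integral_exp_kernel (a / 2) t
  have : (∫ τ in (0 : ℝ)..t, a * Real.exp (-(a * (t - τ) / 2)))
      = 2 * ∫ τ in (0 : ℝ)..t, a / 2 * Real.exp (-(a / 2 * (t - τ))) := by
    rw [← intervalIntegral.integral_const_mul]
    refine intervalIntegral.integral_congr fun τ _ => ?_
    rw [show a / 2 * (t - τ) = a * (t - τ) / 2 by ring]
    ring
  rw [this, h]
  linarith [Real.exp_pos (-(a / 2 * t))]

/-- The Cauchy-Schwarz inequality with a weight `w` of mass at most `M`. -/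
lemma sq_integral_mul_le {κ w h : ℝ → ℝ} {t M : ℝ} (ht : 0 ≤ t) (hM : 0 < M)
    (hκ : Continuous κ) (hw : Continuous w) (hh : Continuous h)
    (hle : ∀ τ ∈ Icc 0 t, |κ τ| ≤ w τ) (hwM : ∫ τ in (0 : ℝ)..t, w τ ≤ M) :
    (∫ τ in (0 : ℝ)..t, κ τ * h τ) ^ 2 ≤ M * ∫ τ in (0 : ℝ)..t, w τ * h τ ^ 2 := by
  set B := ∫ τ in (0 : ℝ)..t, κ τ * h τ with hB
  set C := ∫ τ in (0 : ℝ)..t, w τ * h τ ^ 2 with hC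
  -- The choice that minimises `M m² - 2 m B`; it turns `2 m B ≤ C + m² M` into `B² / M ≤ C`.
  set m := B / M with hm
  have h1 : 2 * m * B ≤ C + m ^ 2 * ∫ τ in (0 : ℝ)..t, w τ := by
    rw [hB, hC, ← intervalIntegral.integral_const_mul, ← intervalIntegral.integral_const_mul,
      ← intervalIntegral.integral_add (Continuous.intervalIntegrable (by fun_prop) _ _)
        (Continuous.intervalIntegrable (by fun_prop) _ _)]
    refine intervalIntegral.integral_mono_on ht (Continuous.intervalIntegrable (by fun_prop) _ _)
      (Continuous.intervalIntegrable (by fun_prop) _ _) fun τ hτ => ?_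
    have h2 := hle τ hτ
    calc 2 * m * (κ τ * h τ) ≤ |2 * m * h τ| * |κ τ| := by
          rw [← abs_mul]; exact (le_of_eq (by ring)).trans (le_abs_self _)
      _ ≤ (m ^ 2 + h τ ^ 2) * w τ := by
          refine mul_le_mul ?_ h2 (abs_nonneg _) (by positivity)
          rw [abs_le]
          constructor <;> nlinarith [sq_nonneg (m - h τ), sq_nonneg (m + h τ)]
      _ = _ := by ring
  have h3 : m ^ 2 * (∫ τ in (0 : ℝ)..t, w τ) ≤ m ^ 2 * M := by gcongr
  have h4 : B = m * M := by rw [hm]; field_simp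
  rw [h4] at h1 ⊢
  nlinarith

/-- Both parts carry the constant `128`: `2 · 8²` for the decay part, where squaring restores the
full rate `l ^ s`, and `8 · 16` for the integral, from the weighted Cauchy-Schwarz inequality with a
weight of mass at most `16`. The square of the difference doubles this. -/
lemma modeRep_sq_le {l c s t : ℝ} (hl : 0 < l) {g : ℝ → ℝ} (hg : Continuous g) (ht : 0 ≤ t)
    (k : ℕ) :
    modeRep l c g k s t ^ 2 ≤ 256 * (Real.log l ^ k) ^ 2 *
      ((c ^ 2 + g t ^ 2) * Real.exp (-(l ^ s * t)) +
        ∫ τ in (0 : ℝ)..t, l ^ s * Real.exp (-(l ^ s * (t - τ) / 2)) * (g τ - g t) ^ 2) := by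
  set A := (c + g t) * decay l k s t with hA
  set B := ∫ τ in (0 : ℝ)..t, kernel l k s (t - τ) * (g τ - g t) with hB
  set C := ∫ τ in (0 : ℝ)..t, l ^ s * Real.exp (-(l ^ s * (t - τ) / 2)) * (g τ - g t) ^ 2 with hC
  have h1 : A ^ 2 ≤ 128 * ((c ^ 2 + g t ^ 2) * Real.exp (-(l ^ s * t))) := by
    have h : decay l k s t ^ 2 ≤ 64 * Real.exp (-(l ^ s * t)) := by
      rw [← sq_abs]
      calc |decay l k s t| ^ 2 ≤ (8 * Real.exp (-(l ^ s * t / 2))) ^ 2 := by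
            gcongr; exact abs_decay_le hl ht k
        _ = 64 * Real.exp (-(l ^ s * t)) := by
            rw [mul_pow, ← Real.exp_nat_mul]; norm_num; ring
    calc A ^ 2 = (c + g t) ^ 2 * decay l k s t ^ 2 := by rw [hA, mul_pow]
      _ ≤ (2 * (c ^ 2 + g t ^ 2)) * (64 * Real.exp (-(l ^ s * t))) := by
          gcongr; nlinarith [sq_nonneg (c - g t)]
      _ = _ := by ring
  have h2 : B ^ 2 ≤ 128 * C := by
    have hk : Continuous fun τ => kernel l k s (t - τ) :=
      (continuous_kernel hl k).comp (by fun_prop : Continuous fun τ : ℝ => (s, t - τ))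
    have h := sq_integral_mul_le (κ := fun τ => kernel l k s (t - τ))
      (w := fun τ => 8 * (l ^ s * Real.exp (-(l ^ s * (t - τ) / 2)))) (h := fun τ => g τ - g t)
      (M := 16) ht (by norm_num) hk (by fun_prop) (by fun_prop)
      (fun τ hτ => abs_kernel_le hl (sub_nonneg.2 hτ.2) k)
      (by rw [intervalIntegral.integral_const_mul]
          linarith [integral_exp_half_kernel_le (a := l ^ s) (t := t)])
    have h8 : (∫ τ in (0 : ℝ)..t, 8 * (l ^ s * Real.exp (-(l ^ s * (t - τ) / 2))) *
        (g τ - g t) ^ 2) = 8 * C := by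
      rw [hC, ← intervalIntegral.integral_const_mul]
      exact intervalIntegral.integral_congr fun τ _ => by ring
    rw [h8] at h
    linarith
  have h3 : (A - B) ^ 2 ≤ 2 * A ^ 2 + 2 * B ^ 2 := by nlinarith [sq_nonneg (A + B)]
  calc modeRep l c g k s t ^ 2 = (Real.log l ^ k) ^ 2 * (A - B) ^ 2 := by rw [modeRep, mul_pow]
    _ ≤ (Real.log l ^ k) ^ 2 *
        (256 * ((c ^ 2 + g t ^ 2) * Real.exp (-(l ^ s * t)) + C)) := by
      gcongr; linarith
    _ = _ := by ring

/-! ### Second moments of the modes -/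

section Expectation

variable {Ω : Type*} [MeasurableSpace Ω]

lemma measurable_uncurry_path {G : ℝ → Ω → ℝ} (hGc : ∀ ω, Continuous fun t => G t ω)
    (hGm : ∀ t, Measurable (G t)) : Measurable fun p : ℝ × Ω => G p.1 p.2 :=
  measurable_uncurry_of_continuous_of_measurable hGc hGm

lemma continuous_modeRep {l c s : ℝ} (hl : 0 < l) {g : ℝ → ℝ} (hg : Continuous g) (k : ℕ) :
    Continuous fun t => modeRep l c g k s t := by
  have hd : Continuous fun t => decay l k s t :=
    (continuous_decay hl k).comp (by fun_prop : Continuous fun t : ℝ => (s, t))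
  have hk : Continuous (fun t τ => kernel l k s (t - τ) * (g τ - g t)).uncurry :=
    ((continuous_kernel hl k).comp
      (by fun_prop : Continuous fun p : ℝ × ℝ => (s, p.1 - p.2))).mul (by fun_prop)
  exact continuous_const.mul (((continuous_const.add hg).mul hd).sub
    (intervalIntegral.continuous_parametric_intervalIntegral_of_continuous hk continuous_id))

/-- The representation is jointly measurable in time and in the random parameter. -/
lemma measurable_modeRep {l c s : ℝ} (hl : 0 < l) {G : ℝ → Ω → ℝ}
    (hGc : ∀ ω, Continuous fun t => G t ω) (hGm : ∀ t, Measurable (G t)) (k : ℕ) :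
    Measurable fun p : ℝ × Ω => modeRep l c (fun t => G t p.2) k s p.1 := by
  refine measurable_uncurry_of_continuous_of_measurable
    (u := fun t ω => modeRep l c (fun t => G t ω) k s t)
    (fun ω => continuous_modeRep hl (hGc ω) k) (fun t => ?_)
  · have hk : Measurable fun τ => kernel l k s (t - τ) :=
      ((continuous_kernel hl k).comp (by fun_prop : Continuous fun τ : ℝ => (s, t - τ))).measurable
    have hG := measurable_uncurry_path hGc hGm
    have hF : Measurable fun p : Ω × ℝ => kernel l k s (t - p.2) * (G p.2 p.1 - G t p.1) :=
      (hk.comp measurable_snd).mul ((hG.comp measurable_swap).sub ((hGm t).comp measurable_fst))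
    have hI : Measurable fun ω => ∫ τ in (0 : ℝ)..t, kernel l k s (t - τ) * (G τ ω - G t ω) := by
      simp only [intervalIntegral]
      exact (hF.stronglyMeasurable.integral_prod_right.sub
        hF.stronglyMeasurable.integral_prod_right).measurable
    exact measurable_const.mul (((measurable_const.add (hGm t)).mul measurable_const).sub hI)

lemma lintegral_exp_neg_le {a : ℝ} (ha : 0 < a) :
    ∫⁻ t in Ioi (0 : ℝ), ENNReal.ofReal (Real.exp (-(a * t))) ≤ ENNReal.ofReal (1 / a) := by
  have h := integral_exp_mul_Ioi (neg_lt_zero.2 ha) 0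
  rw [← ofReal_integral_eq_lintegral_ofReal
    (by simpa only [neg_mul, IntegrableOn] using integrableOn_exp_mul_Ioi (neg_lt_zero.2 ha) 0)
    (Eventually.of_forall fun _ => (Real.exp_pos _).le)]
  refine ENNReal.ofReal_le_ofReal (le_of_eq ?_)
  simpa using h

/-- From `a t ≤ a t + 1 ≤ e^{at}`. It trades the variance `t` of the noise for the gain `1 / a`. -/
lemma mul_exp_neg_le_inv {a t : ℝ} (ha : 0 < a) : t * Real.exp (-(a * t)) ≤ 1 / a := by
  rw [le_div_iff₀ ha, Real.exp_neg]
  have := Real.add_one_le_exp (a * t)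
  rw [mul_assoc, inv_mul_eq_div, mul_div_assoc', div_le_one (Real.exp_pos _)]
  linarith

/-- The expected kernel term. -/
lemma lintegral_kernel_mul_le {a t : ℝ} (ha : 0 < a) :
    ∫⁻ τ in Ioc 0 t, ENNReal.ofReal (a * Real.exp (-(a * (t - τ) / 2))) * ENNReal.ofReal (t - τ)
      ≤ ENNReal.ofReal (16 / a) := by
  -- The decay is split in two: one factor `e^{-ar/4}` absorbs `r` at the cost of `4 / a`, the other
  -- is left to integrate and gives another `4 / a`.
  have hpt : ∀ r : ℝ, a * Real.exp (-(a * r / 2)) * r ≤ 4 * Real.exp (-(a / 4 * r)) := by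
    intro r
    have h1 := mul_exp_neg_le_inv (t := r) (by positivity : 0 < a / 4)
    have h2 : Real.exp (-(a * r / 2)) = Real.exp (-(a / 4 * r)) * Real.exp (-(a / 4 * r)) := by
      rw [← Real.exp_add]; congr 1; ring
    calc a * Real.exp (-(a * r / 2)) * r
        = a * (r * Real.exp (-(a / 4 * r))) * Real.exp (-(a / 4 * r)) := by rw [h2]; ring
      _ ≤ a * (1 / (a / 4)) * Real.exp (-(a / 4 * r)) := by gcongr
      _ = _ := by field_simp
  have hint : IntegrableOn (fun τ => 4 * Real.exp (-(a / 4 * (t - τ)))) (Ioc 0 t) :=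
    (Continuous.integrableOn_Icc (by fun_prop)).mono_set Ioc_subset_Icc_self
  rcases le_or_gt t 0 with ht | ht
  · simp [Ioc_eq_empty ht.not_gt]
  calc _ ≤ ∫⁻ τ in Ioc 0 t, ENNReal.ofReal (4 * Real.exp (-(a / 4 * (t - τ)))) := by
        refine lintegral_mono fun τ => ?_
        rw [← ENNReal.ofReal_mul (by positivity)]
        exact ENNReal.ofReal_le_ofReal (hpt _)
    _ = ENNReal.ofReal (∫ τ in Ioc 0 t, 4 * Real.exp (-(a / 4 * (t - τ)))) :=
        (ofReal_integral_eq_lintegral_ofReal hint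
          (Eventually.of_forall fun τ => by positivity)).symm
    _ ≤ _ := by
        refine ENNReal.ofReal_le_ofReal ?_
        rw [← intervalIntegral.integral_of_le ht.le]
        have h := integral_exp_kernel (a / 4) t
        rw [intervalIntegral.integral_const_mul] at h ⊢
        have h3 : (∫ τ in (0 : ℝ)..t, Real.exp (-(a / 4 * (t - τ))))
            = 4 / a * (1 - Real.exp (-(a / 4 * t))) := by rw [← h]; field_simp
        rw [h3]
        have := Real.exp_pos (-(a / 4 * t))
        calc 4 * (4 / a * (1 - Real.exp (-(a / 4 * t)))) ≤ 4 * (4 / a * 1) := by gcongr; linarith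
          _ = 16 / a := by ring

/-- The expectation of the squared derivatives of a mode at a fixed time. -/
lemma lintegral_modeRep_sq_le {P : Measure Ω} [IsProbabilityMeasure P] {l c s T m : ℝ} (hl : 0 < l)
    (hm : 0 ≤ m) {G : ℝ → Ω → ℝ} (hGc : ∀ ω, Continuous fun t => G t ω)
    (hGm : ∀ t, Measurable (G t))
    (h0 : ∀ t ∈ Icc 0 T, ∫⁻ ω, ENNReal.ofReal (G t ω ^ 2) ∂P ≤ ENNReal.ofReal (m * t))
    (hinc : ∀ τ t, 0 ≤ τ → τ ≤ t → t ≤ T →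
      ∫⁻ ω, ENNReal.ofReal ((G τ ω - G t ω) ^ 2) ∂P ≤ ENNReal.ofReal (m * (t - τ)))
    (k : ℕ) {t : ℝ} (ht : t ∈ Icc 0 T) :
    ∫⁻ ω, ENNReal.ofReal (modeRep l c (fun t => G t ω) k s t ^ 2) ∂P ≤
      ENNReal.ofReal (256 * (Real.log l ^ k) ^ 2) *
        (ENNReal.ofReal (c ^ 2) * ENNReal.ofReal (Real.exp (-(l ^ s * t)))
          + ENNReal.ofReal (17 * m / l ^ s)) := by
  set a := l ^ s with ha'
  have ha : 0 < a := Real.rpow_pos_of_pos hl s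
  have hG := measurable_uncurry_path hGc hGm
  have hpath : ∀ ω, ENNReal.ofReal (modeRep l c (fun t => G t ω) k s t ^ 2) ≤
      ENNReal.ofReal (256 * (Real.log l ^ k) ^ 2) *
        (ENNReal.ofReal (c ^ 2) * ENNReal.ofReal (Real.exp (-(a * t)))
          + (ENNReal.ofReal (Real.exp (-(a * t))) * ENNReal.ofReal (G t ω ^ 2)
          + ∫⁻ τ in Ioc 0 t, ENNReal.ofReal (a * Real.exp (-(a * (t - τ) / 2))) *
              ENNReal.ofReal ((G τ ω - G t ω) ^ 2))) := by
    intro ω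
    refine (ENNReal.ofReal_le_ofReal (modeRep_sq_le hl (hGc ω) ht.1 k)).trans (le_of_eq ?_)
    have hc : Continuous fun τ => a * Real.exp (-(a * (t - τ) / 2)) * (G τ ω - G t ω) ^ 2 := by
      have := hGc ω
      fun_prop
    have hnn : ∀ τ, 0 ≤ a * Real.exp (-(a * (t - τ) / 2)) * (G τ ω - G t ω) ^ 2 :=
      fun τ => by positivity
    have hnn' : ∀ τ, 0 ≤ a * Real.exp (-(a * (t - τ) / 2)) := fun τ => by positivity
    rw [ENNReal.ofReal_mul (by positivity), intervalIntegral.integral_of_le ht.1,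
      ENNReal.ofReal_add (by positivity) (integral_nonneg hnn), add_mul,
      ENNReal.ofReal_add (by positivity) (by positivity), ENNReal.ofReal_mul (sq_nonneg c),
      ENNReal.ofReal_mul (sq_nonneg (G t ω)), add_assoc,
      mul_comm (ENNReal.ofReal (G t ω ^ 2)),
      ofReal_integral_eq_lintegral_ofReal (hc.integrableOn_Icc.mono_set Ioc_subset_Icc_self)
        (Eventually.of_forall hnn)]
    simp_rw [ENNReal.ofReal_mul (hnn' _)]
    rfl
  have hmt : Measurable fun ω => ENNReal.ofReal (G t ω ^ 2) :=
    ENNReal.measurable_ofReal.comp ((hGm t).pow_const 2)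
  have hmτ : Measurable fun p : Ω × ℝ => ENNReal.ofReal (a * Real.exp (-(a * (t - p.2) / 2))) *
              ENNReal.ofReal ((G p.2 p.1 - G t p.1) ^ 2) := by
    refine Measurable.mul ?_ (ENNReal.measurable_ofReal.comp
      (((hG.comp measurable_swap).sub ((hGm t).comp measurable_fst)).pow_const 2))
    fun_prop
  have hE1 : ∫⁻ ω, ENNReal.ofReal (Real.exp (-(a * t))) * ENNReal.ofReal (G t ω ^ 2) ∂P
      ≤ ENNReal.ofReal (m / a) := by
    rw [lintegral_const_mul _ hmt]
    calc _ ≤ ENNReal.ofReal (Real.exp (-(a * t))) * ENNReal.ofReal (m * t) := by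
          gcongr; exact h0 t ht
      _ = ENNReal.ofReal (m * (t * Real.exp (-(a * t)))) := by
          rw [← ENNReal.ofReal_mul (by positivity)]; congr 1; ring
      _ ≤ ENNReal.ofReal (m * (1 / a)) := by
          refine ENNReal.ofReal_le_ofReal ?_
          gcongr
          exact mul_exp_neg_le_inv ha
      _ = _ := by rw [mul_one_div]
  have hE2 : ∫⁻ ω, (∫⁻ τ in Ioc 0 t, ENNReal.ofReal (a * Real.exp (-(a * (t - τ) / 2))) *
              ENNReal.ofReal ((G τ ω - G t ω) ^ 2)) ∂P ≤ ENNReal.ofReal (16 * m / a) := by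
    -- With the expectation inside, the squared increment becomes `m (t - τ)`, which vanishes where
    -- the kernel concentrates.
    rw [lintegral_lintegral_swap hmτ.aemeasurable]
    calc _ ≤ ∫⁻ τ in Ioc 0 t, ENNReal.ofReal m *
          (ENNReal.ofReal (a * Real.exp (-(a * (t - τ) / 2))) * ENNReal.ofReal (t - τ)) := by
          refine setLIntegral_mono' measurableSet_Ioc fun τ hτ => ?_
          rw [lintegral_const_mul _ (by
            exact ENNReal.measurable_ofReal.comp (((hGm τ).sub (hGm t)).pow_const 2)),
            mul_left_comm, ← ENNReal.ofReal_mul hm]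
          gcongr
          exact hinc τ t hτ.1.le hτ.2 ht.2
      _ = ENNReal.ofReal m * ∫⁻ τ in Ioc 0 t,
          ENNReal.ofReal (a * Real.exp (-(a * (t - τ) / 2))) * ENNReal.ofReal (t - τ) :=
          lintegral_const_mul _ (by fun_prop)
      _ ≤ ENNReal.ofReal m * ENNReal.ofReal (16 / a) := by
          gcongr; exact lintegral_kernel_mul_le ha
      _ = _ := by rw [← ENNReal.ofReal_mul hm]; congr 1; ring
  calc _ ≤ _ := lintegral_mono hpath
    _ = ENNReal.ofReal (256 * (Real.log l ^ k) ^ 2) *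
        (ENNReal.ofReal (c ^ 2) * ENNReal.ofReal (Real.exp (-(a * t)))
          + (∫⁻ ω, ENNReal.ofReal (Real.exp (-(a * t))) * ENNReal.ofReal (G t ω ^ 2) ∂P
          + ∫⁻ ω, (∫⁻ τ in Ioc 0 t, ENNReal.ofReal (a * Real.exp (-(a * (t - τ) / 2))) *
              ENNReal.ofReal ((G τ ω - G t ω) ^ 2)) ∂P)) := by
        have hm1 := hmt.const_mul (ENNReal.ofReal (Real.exp (-(a * t))))
        have hm2 := hmτ.lintegral_prod_right' (ν := volume.restrict (Ioc 0 t))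
        rw [lintegral_const_mul _ (by exact measurable_const.add (hm1.add hm2)),
          lintegral_add_left measurable_const, lintegral_add_left hm1]
        simp
    _ ≤ ENNReal.ofReal (256 * (Real.log l ^ k) ^ 2) *
        (ENNReal.ofReal (c ^ 2) * ENNReal.ofReal (Real.exp (-(a * t)))
          + (ENNReal.ofReal (m / a) + ENNReal.ofReal (16 * m / a))) := by gcongr
    -- The constant `17` is `1` from the noise at time `t` plus `16` from the kernel term.
    _ = _ := by
        rw [← ENNReal.ofReal_add (by positivity) (by positivity)]
        congr 3; ring

/-- The expectation of the squared norm in `L²(0, T)` of the derivatives of a mode. -/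
lemma lintegral_lintegral_modeRep_sq_le {P : Measure Ω} [IsProbabilityMeasure P] {l c s T m : ℝ}
    (hl : 0 < l) (hT : 0 ≤ T) (hm : 0 ≤ m) {G : ℝ → Ω → ℝ} (hGc : ∀ ω, Continuous fun t => G t ω)
    (hGm : ∀ t, Measurable (G t))
    (h0 : ∀ t ∈ Icc 0 T, ∫⁻ ω, ENNReal.ofReal (G t ω ^ 2) ∂P ≤ ENNReal.ofReal (m * t))
    (hinc : ∀ τ t, 0 ≤ τ → τ ≤ t → t ≤ T →
      ∫⁻ ω, ENNReal.ofReal ((G τ ω - G t ω) ^ 2) ∂P ≤ ENNReal.ofReal (m * (t - τ)))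
    (k : ℕ) :
    ∫⁻ ω, (∫⁻ t in Icc 0 T, ENNReal.ofReal (modeRep l c (fun t => G t ω) k s t ^ 2)) ∂P ≤
      ENNReal.ofReal (256 * (Real.log l ^ k) ^ 2 / l ^ s * (c ^ 2 + 17 * m * T)) := by
  have ha : 0 < l ^ s := Real.rpow_pos_of_pos hl s
  have hM : Measurable fun p : Ω × ℝ =>
      ENNReal.ofReal (modeRep l c (fun t => G t p.1) k s p.2 ^ 2) :=
    ENNReal.measurable_ofReal.comp
      (((measurable_modeRep hl hGc hGm k).comp measurable_swap).pow_const 2)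
  have hme : Measurable fun t : ℝ => ENNReal.ofReal (Real.exp (-(l ^ s * t))) := by fun_prop
  rw [lintegral_lintegral_swap hM.aemeasurable]
  calc _ ≤ ∫⁻ t in Icc 0 T, ENNReal.ofReal (256 * (Real.log l ^ k) ^ 2) *
        (ENNReal.ofReal (c ^ 2) * ENNReal.ofReal (Real.exp (-(l ^ s * t)))
          + ENNReal.ofReal (17 * m / l ^ s)) :=
        setLIntegral_mono' measurableSet_Icc fun t ht =>
          lintegral_modeRep_sq_le hl hm hGc hGm h0 hinc k ht
    _ = ENNReal.ofReal (256 * (Real.log l ^ k) ^ 2) *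
        (ENNReal.ofReal (c ^ 2) * (∫⁻ t in Icc 0 T, ENNReal.ofReal (Real.exp (-(l ^ s * t))))
          + ENNReal.ofReal (17 * m / l ^ s) * ENNReal.ofReal T) := by
        rw [lintegral_const_mul _ ((hme.const_mul _).add_const _),
          lintegral_add_right _ measurable_const, lintegral_const_mul _ hme]
        simp
    _ ≤ ENNReal.ofReal (256 * (Real.log l ^ k) ^ 2) *
        (ENNReal.ofReal (c ^ 2) * ENNReal.ofReal (1 / l ^ s)
          + ENNReal.ofReal (17 * m / l ^ s) * ENNReal.ofReal T) := by
        -- The deterministic initial value has no small factor at a fixed time; it gains `1 / l ^ s`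
        -- only from the integration in time.
        gcongr
        rw [setLIntegral_congr Ioc_ae_eq_Icc.symm]
        exact (lintegral_mono_set Ioc_subset_Ioi_self).trans (lintegral_exp_neg_le ha)
    _ = _ := by
        rw [← ENNReal.ofReal_mul (by positivity), ← ENNReal.ofReal_mul (by positivity),
          ← ENNReal.ofReal_add (by positivity) (by positivity), ← ENNReal.ofReal_mul (by positivity)]
        congr 1; ring

end Expectation

/-! ### Uniformity over the eigenvalues -/

/-- The factors `(log l) ^ (2 k) / l ^ s` are bounded for `l` away from zero. -/
lemma exists_log_pow_div_rpow_le {l₀ s : ℝ} (hl₀ : 0 < l₀) (hs : 0 < s) (k : ℕ) :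
    ∃ C : ℝ, 0 ≤ C ∧ ∀ l, l₀ ≤ l → (Real.log l ^ k) ^ 2 / l ^ s ≤ C := by
  -- Powers beat logarithms at infinity; on the remaining compact interval, away from zero,
  -- continuity suffices.
  have h1 : Tendsto (fun l : ℝ => (Real.log l ^ k) ^ 2 / l ^ s) atTop (𝓝 0) := by
    have := (isLittleO_log_rpow_rpow_atTop (s := s) ((2 * k : ℕ) : ℝ) hs).tendsto_div_nhds_zero
    refine this.congr fun l => ?_
    rw [Real.rpow_natCast, ← pow_mul, mul_comm k]
  obtain ⟨N, hN⟩ := eventually_atTop.1 (h1.eventually_le_const one_pos)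
  have hc : ContinuousOn (fun l : ℝ => (Real.log l ^ k) ^ 2 / l ^ s) (Icc l₀ (max N l₀)) := by
    have hne : ∀ l ∈ Icc l₀ (max N l₀), l ≠ 0 := fun l hl => (hl₀.trans_le hl.1).ne'
    refine ContinuousOn.div (((continuousOn_id.log hne).pow k).pow 2)
      (continuousOn_id.rpow_const fun l hl => Or.inl (hne l hl)) fun l hl => ?_
    exact (Real.rpow_pos_of_pos (hl₀.trans_le hl.1) s).ne'
  obtain ⟨C, hC⟩ := isCompact_Icc.bddAbove_image hc
  refine ⟨max C 1, by positivity, fun l hl => ?_⟩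
  rcases le_total l (max N l₀) with h | h
  · exact (hC ⟨l, ⟨hl, h⟩, rfl⟩).trans (le_max_left _ _)
  · exact (hN l ((le_max_left _ _).trans h)).trans (le_max_right _ _)

/-! ### Orthogonal series in a Hilbert space -/

section Orthogonal

variable {H : Type*} [NormedAddCommGroup H] [InnerProductSpace ℝ H]

lemma norm_sum_sq_of_pairwise_orthogonal {u : ℕ → H} (h : ∀ i j, i ≠ j → ⟪u i, u j⟫ = 0)
    (s : Finset ℕ) : ‖∑ j ∈ s, u j‖ ^ 2 = ∑ j ∈ s, ‖u j‖ ^ 2 := by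
  rw [← real_inner_self_eq_norm_sq, sum_inner]
  refine Finset.sum_congr rfl fun i hi => ?_
  rw [inner_sum, Finset.sum_eq_single i (fun j _ hj => h i j hj.symm) (fun hi' => (hi' hi).elim),
    real_inner_self_eq_norm_sq]

/-- The terms may vanish, so they are not normalised: the criterion for orthogonal families is
applied to the lines they span. -/
lemma summable_of_pairwise_orthogonal [CompleteSpace H] {u : ℕ → H}
    (h : ∀ i j, i ≠ j → ⟪u i, u j⟫ = 0) (hs : Summable fun j => ‖u j‖ ^ 2) : Summable u := by
  have hV : OrthogonalFamily ℝ (fun j => Submodule.span ℝ {u j})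
      fun j => (Submodule.span ℝ {u j}).subtypeₗᵢ := by
    intro i j hij v w
    obtain ⟨a, ha⟩ := Submodule.mem_span_singleton.1 v.2
    obtain ⟨b, hb⟩ := Submodule.mem_span_singleton.1 w.2
    simp [← ha, ← hb, inner_smul_left, inner_smul_right, h i j hij]
  exact (hV.summable_iff_norm_sq_summable
    fun j => ⟨u j, Submodule.mem_span_singleton_self (u j)⟩).2 hs

lemma hasSum_norm_sq_of_pairwise_orthogonal {u : ℕ → H} {U : H}
    (h : ∀ i j, i ≠ j → ⟪u i, u j⟫ = 0) (hU : HasSum u U) :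
    HasSum (fun j => ‖u j‖ ^ 2) (‖U‖ ^ 2) :=
  ((continuous_norm.pow 2).tendsto U |>.comp hU).congr fun s =>
    norm_sum_sq_of_pairwise_orthogonal h s

end Orthogonal

/-! ### Measurability of Hilbert space valued maps -/

section Measurability

variable {Ω H : Type*} [MeasurableSpace Ω] [NormedAddCommGroup H] [InnerProductSpace ℝ H]

/-- An orthonormal family in a separable space is countable. -/
lemma countable_of_orthonormal {ι : Type*} [SecondCountableTopology H] {b : ι → H}
    (hb : Orthonormal ℝ b) : Countable ι := by
  have hd : Pairwise (Function.onFun Disjoint fun i => Metric.ball (b i) (1 / 2)) := by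
    intro i j hij
    refine Metric.ball_disjoint_ball ?_
    -- Distinct members are at distance `√2 > 1`, so the balls of radius `1 / 2` are disjoint.
    have h : ‖b i - b j‖ ^ 2 = 2 := by
      rw [norm_sub_sq_real, hb.1, hb.1, hb.2 hij]; norm_num
    rw [dist_eq_norm]
    nlinarith [norm_nonneg (b i - b j)]
  exact hd.countable_of_isOpen_disjoint (fun i => Metric.isOpen_ball)
    fun i => ⟨b i, Metric.mem_ball_self (by norm_num)⟩

/-- Weak measurability implies strong measurability in a separable Hilbert space. -/
lemma stronglyMeasurable_of_inner [CompleteSpace H] [SecondCountableTopology H] {v : Ω → H}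
    (h : ∀ w, Measurable fun ω => ⟪w, v ω⟫) : StronglyMeasurable v := by
  obtain ⟨w, b, -⟩ := exists_hilbertBasis ℝ H
  -- Needed for `atTop` on `Finset w` to be countably generated, so that limits along it stay
  -- measurable.
  have : Countable w := countable_of_orthonormal b.orthonormal
  refine stronglyMeasurable_of_tendsto (atTop : Filter (Finset w))
    (f := fun s ω => ∑ i ∈ s, ⟪b i, v ω⟫ • b i) (fun s => ?_) (tendsto_pi_nhds.2 fun ω => ?_)
  · exact Finset.stronglyMeasurable_fun_sum s fun i _ =>
      (h (b i)).stronglyMeasurable.smul_const (b i)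
  · simpa only [HasSum, b.repr_apply_apply, SummationFilter.unconditional_filter]
      using b.hasSum_repr (v ω)

/-- The sections of a jointly measurable function depend measurably on the parameter,
as elements of `L²`. -/
lemma stronglyMeasurable_toLp {X : Type*} [MeasurableSpace X]
    [MeasurableSpace.CountablyGenerated X] {μ : Measure X} [SFinite μ] {F : Ω → X → ℝ}
    (hF : Measurable F.uncurry) (hL : ∀ ω, MemLp (F ω) 2 μ) :
    StronglyMeasurable fun ω => (hL ω).toLp (F ω) := by
  have : Fact ((2 : ℝ≥0∞) ≠ ∞) := ⟨by simp⟩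
  refine stronglyMeasurable_of_inner fun w => ?_
  have h : ∀ ω, ⟪w, (hL ω).toLp (F ω)⟫ = ∫ x, w x * F ω x ∂μ := fun ω => by
    rw [L2.inner_def]
    refine integral_congr_ae ?_
    filter_upwards [(hL ω).coeFn_toLp] with x hx
    rw [hx]
    simp [mul_comm]
  simp_rw [h]
  have hm : StronglyMeasurable fun p : Ω × X => w p.2 * F p.1 p.2 :=
    (((Lp.stronglyMeasurable w).measurable.comp measurable_snd).mul hF).stronglyMeasurable
  exact hm.integral_prod_right.measurable

end Measurability

/-! ### Orthogonal series of random vectors -/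

section LpSeries

variable {Ω H : Type*} [MeasurableSpace Ω] {P : Measure Ω} [NormedAddCommGroup H]

lemma eLpNorm_two_sq (f : Ω → H) : eLpNorm f 2 P ^ 2 = ∫⁻ ω, ‖f ω‖ₑ ^ 2 ∂P := by
  have := eLpNorm_nnreal_pow_eq_lintegral (f := f) (μ := P) (p := 2) two_ne_zero
  simpa using this

lemma memLp_two_of_lintegral_lt_top {f : Ω → H} (hf : AEStronglyMeasurable f P)
    (h : ∫⁻ ω, ‖f ω‖ₑ ^ 2 ∂P < ∞) : MemLp f 2 P := by
  refine ⟨hf, ?_⟩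
  rw [← eLpNorm_two_sq] at h
  by_contra hc
  rw [not_lt, top_le_iff] at hc
  simp [hc] at h

lemma lintegral_enorm_sq_Lp (f : Lp H 2 P) :
    ∫⁻ ω, ‖f ω‖ₑ ^ 2 ∂P = ENNReal.ofReal (‖f‖ ^ 2) := by
  rw [← eLpNorm_two_sq, Lp.norm_def, ← ENNReal.toReal_pow,
    ENNReal.ofReal_toReal (ENNReal.pow_ne_top (Lp.eLpNorm_ne_top f))]

/-- A series in `L²(P; H)` whose terms are pointwise orthogonal and whose squared norms are
summable converges in `L²(P; H)`, and almost surely in `H`, to the same sum. -/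
lemma exists_hasSum_Lp_of_orthogonal [InnerProductSpace ℝ H] [CompleteSpace H]
    {u : ℕ → Lp H 2 P} (horth : ∀ᵐ ω ∂P, ∀ i j, i ≠ j → ⟪u i ω, u j ω⟫ = 0)
    (hs : Summable fun j => ‖u j‖ ^ 2) :
    ∃ U : Lp H 2 P, HasSum u U ∧ ∀ᵐ ω ∂P, HasSum (fun j => u j ω) (U ω) := by
  have hort : ∀ i j, i ≠ j → ⟪u i, u j⟫ = 0 := by
    intro i j hij
    rw [L2.inner_def]
    refine integral_eq_zero_of_ae ?_
    filter_upwards [horth] with ω hω using hω i j hij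
  have hsum := summable_of_pairwise_orthogonal hort hs
  refine ⟨∑' j, u j, hsum.hasSum, ?_⟩
  -- By Tonelli the sum of the squared norms has finite expectation, hence is finite almost surely,
  -- and the series converges path by path.
  have hfin : ∫⁻ ω, ∑' j, ‖u j ω‖ₑ ^ 2 ∂P ≠ ∞ := by
    rw [lintegral_tsum fun j => ((Lp.stronglyMeasurable (u j)).enorm.pow_const 2).aemeasurable]
    simp_rw [lintegral_enorm_sq_Lp]
    exact hs.tsum_ofReal_ne_top
  have hae : ∀ᵐ ω ∂P, ∑' j, ‖u j ω‖ₑ ^ 2 < ∞ :=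
    ae_lt_top (Measurable.tsum fun j =>
      (Lp.stronglyMeasurable (u j)).enorm.pow_const 2) hfin
  -- A subsequence of the partial sums converges almost surely to the `L²` sum, which identifies it
  -- with the pathwise sum.
  obtain ⟨ns, hns, hlim⟩ :=
    (tendstoInMeasure_of_tendsto_Lp hsum.hasSum.tendsto_sum_nat).exists_seq_tendsto_ae
  have hcoe : ∀ᵐ ω ∂P, ∀ n, (∑ j ∈ Finset.range n, u j : Lp H 2 P) ω
      = ∑ j ∈ Finset.range n, u j ω :=
    ae_all_iff.2 fun n => Lp.coeFn_fun_finsetSum _ _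
  filter_upwards [horth, hae, hlim, hcoe] with ω hω hωs hωl hωc
  have hsω : Summable fun j => u j ω := by
    refine summable_of_pairwise_orthogonal hω ?_
    have := ENNReal.summable_toReal hωs.ne
    simpa using this
  have h1 := hsω.hasSum.tendsto_sum_nat.comp hns.tendsto_atTop
  simp only [hωc] at hωl
  rw [← tendsto_nhds_unique h1 hωl]
  exact hsω.hasSum

end LpSeries

/-! ### Products of a time function and a space function -/

section Cylinder

variable {E : Type*} [NormedAddCommGroup E] [InnerProductSpace ℝ E] [FiniteDimensional ℝ E]
  [MeasurableSpace E] [BorelSpace E]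

lemma lintegral_cylMeasure_mul (D : Set E) (T : ℝ) {f : ℝ → ℝ} (hf : Measurable f) (φ : L2D D) :
    ∫⁻ p, ‖f p.2 * φ p.1‖ₑ ^ 2 ∂(cylMeasure D T)
      = ENNReal.ofReal (‖φ‖ ^ 2) * ∫⁻ t in Icc 0 T, ENNReal.ofReal (f t ^ 2) := by
  have h : ∀ p : E × ℝ, ‖f p.2 * φ p.1‖ₑ ^ 2 = ‖φ p.1‖ₑ ^ 2 * ENNReal.ofReal (f p.2 ^ 2) := by
    intro p
    rw [enorm_mul, mul_pow, mul_comm, ← sq_abs, ENNReal.ofReal_pow (abs_nonneg _),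
      ← Real.norm_eq_abs, ofReal_norm]
  simp_rw [h]
  rw [cylMeasure, lintegral_prod_mul (f := fun x => ‖φ x‖ₑ ^ 2)
    (g := fun t => ENNReal.ofReal (f t ^ 2))
    ((Lp.stronglyMeasurable φ).enorm.pow_const 2).aemeasurable
    (ENNReal.measurable_ofReal.comp (hf.pow_const 2)).aemeasurable, lintegral_enorm_sq_Lp]

lemma measurable_mul_coeFn {D : Set E} {f : ℝ → ℝ} (hf : Measurable f) (φ : L2D D) :
    Measurable fun p : E × ℝ => f p.2 * φ p.1 :=
  (hf.comp measurable_snd).mul ((Lp.stronglyMeasurable φ).measurable.comp measurable_fst)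

lemma memLp_cylMeasure_mul (D : Set E) (T : ℝ) {f : ℝ → ℝ} (hf : Continuous f) (φ : L2D D) :
    MemLp (fun p : E × ℝ => f p.2 * φ p.1) 2 (cylMeasure D T) := by
  refine memLp_two_of_lintegral_lt_top (measurable_mul_coeFn hf.measurable φ).aestronglyMeasurable ?_
  rw [lintegral_cylMeasure_mul D T hf.measurable]
  refine ENNReal.mul_lt_top ENNReal.ofReal_lt_top ?_
  rw [← ofReal_integral_eq_lintegral_ofReal (Continuous.integrableOn_Icc (by fun_prop))
    (Eventually.of_forall fun t => sq_nonneg _)]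
  exact ENNReal.ofReal_lt_top

lemma ofReal_norm_sq_toLp_mul (D : Set E) (T : ℝ) {f : ℝ → ℝ} (hf : Continuous f) {φ : L2D D}
    (hφ : ‖φ‖ = 1) :
    ENNReal.ofReal (‖(memLp_cylMeasure_mul D T hf φ).toLp _‖ ^ 2)
      = ∫⁻ t in Icc 0 T, ENNReal.ofReal (f t ^ 2) := by
  rw [← lintegral_enorm_sq_Lp, lintegral_congr_ae
    ((memLp_cylMeasure_mul D T hf φ).coeFn_toLp.mono fun p hp => by
      show _ = ‖f p.2 * φ p.1‖ₑ ^ 2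
      rw [hp]), lintegral_cylMeasure_mul D T hf.measurable, hφ]
  simp

/-- By Fubini the inner product factorises, and the spatial factor already vanishes, whatever the
time functions are. -/
lemma inner_toLp_mul_eq_zero (D : Set E) (T : ℝ) {f g : ℝ → ℝ} (hf : Continuous f)
    (hg : Continuous g) {φ ψ : L2D D} (h : ⟪φ, ψ⟫ = 0) :
    ⟪(memLp_cylMeasure_mul D T hf φ).toLp _, (memLp_cylMeasure_mul D T hg ψ).toLp _⟫ = 0 := by
  rw [L2.inner_def] at h ⊢
  have : (∫ p, (φ p.1 * ψ p.1) * (f p.2 * g p.2) ∂(cylMeasure D T)) = 0 := by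
    rw [cylMeasure, integral_prod_mul (f := fun x => φ x * ψ x) (g := fun t => f t * g t)]
    have : (∫ x in D, φ x * ψ x) = 0 := by
      rw [← h]
      refine integral_congr_ae (Eventually.of_forall fun x => ?_)
      simp [mul_comm]
    rw [this, zero_mul]
  rw [← this]
  refine integral_congr_ae ?_
  filter_upwards [(memLp_cylMeasure_mul D T hf φ).coeFn_toLp,
    (memLp_cylMeasure_mul D T hg ψ).coeFn_toLp] with p h1 h2
  rw [h1, h2]
  simp only [RCLike.inner_apply, conj_trivial]
  ring

end Cylinder

/-! ### Eigenvalues and noise of the modes -/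

section Modes

variable {H : Type*} [NormedAddCommGroup H] [InnerProductSpace ℝ H]

/-- The eigenvalues of an operator with bounded inverse are bounded away from zero. -/
lemma exists_pos_le_eigenvalue [CompleteSpace H] {L : H →ₗ.[ℝ] H} (hL : IsDiffusionOperator L)
    {e : HilbertBasis ℕ ℝ H} {lam : ℕ → ℝ} (he : IsEigenbasis L e lam) :
    ∃ l₀ : ℝ, 0 < l₀ ∧ ∀ j, l₀ ≤ lam j := by
  obtain ⟨K, -, hK, -⟩ := hL.compact_inverse
  -- `K (e j) = (lam j)⁻¹ • e j` gives `1 ≤ lam j * ‖K‖`; the added `1` avoids having to prove `K ≠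
  -- 0`.
  refine ⟨1 / (‖K‖ + 1), by positivity, fun j => ?_⟩
  obtain ⟨h, hj⟩ := he j
  have h1 : ‖e j‖ = 1 := e.orthonormal.1 j
  have hne : (⟨e j, h⟩ : L.domain) ≠ 0 := fun h0 => by
    have : e j = 0 := congrArg Subtype.val h0
    simp [this] at h1
  have hpos := hL.positive _ hne
  rw [hj, real_inner_smul_left, real_inner_self_eq_norm_sq, h1, one_pow, mul_one] at hpos
  have hk := hK ⟨e j, h⟩
  rw [hj, map_smul] at hk
  have h2 : 1 = lam j * ‖K (e j)‖ := by
    rw [← h1, ← abs_of_pos hpos, ← Real.norm_eq_abs, ← norm_smul]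
    exact (congrArg norm hk).symm
  have h3 : ‖K (e j)‖ ≤ ‖K‖ + 1 := by
    have := K.le_opNorm (e j)
    rw [h1, mul_one] at this
    linarith
  rw [div_le_iff₀ (by positivity)]
  exact h2.trans_le (mul_le_mul_of_nonneg_left h3 hpos.le)

lemma IsCovariance.inner_eq {Q : H →L[ℝ] H} {e : HilbertBasis ℕ ℝ H} {mu : ℕ → ℝ}
    (hQ : IsCovariance Q e mu) (j : ℕ) : ⟪Q (e j), e j⟫ = mu j := by
  rw [hQ.eigen, real_inner_smul_left, real_inner_self_eq_norm_sq, e.orthonormal.1 j]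
  simp

lemma IsCovariance.nonneg {Q : H →L[ℝ] H} {e : HilbertBasis ℕ ℝ H} {mu : ℕ → ℝ}
    (hQ : IsCovariance Q e mu) (j : ℕ) : 0 ≤ mu j := by
  rw [← hQ.inner_eq j]
  exact hQ.isPositive.inner_nonneg_left (e j)

lemma IsCovariance.summable {Q : H →L[ℝ] H} {e : HilbertBasis ℕ ℝ H} {mu : ℕ → ℝ}
    (hQ : IsCovariance Q e mu) : Summable mu := by
  simpa only [hQ.inner_eq] using hQ.finite_trace

lemma lintegral_sq_gaussianReal (v : ℝ≥0) :
    ∫⁻ x, ENNReal.ofReal (x ^ 2) ∂(gaussianReal 0 v) = v := by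
  have h : ∫ x, x ^ 2 ∂(gaussianReal 0 v) = v := by
    have := variance_id_gaussianReal (μ := 0) (v := v)
    rwa [variance_of_integral_eq_zero aemeasurable_id (by simp)] at this
  rw [← ofReal_integral_eq_lintegral_ofReal
    (by simpa using (memLp_id_gaussianReal (μ := 0) (v := v) 2).integrable_sq)
    (Eventually.of_forall fun x => sq_nonneg x), h, ENNReal.ofReal_coe_nnreal]

variable {Ω : Type*} {T : ℝ}

/-- The noise of the `j`-th mode, extended to all times by constants, and set to zero outside of
the event `A`. -/
def modeNoise (hT : 0 ≤ T) (e : HilbertBasis ℕ ℝ H) (mu : ℕ → ℝ) (W : Icc (0 : ℝ) T → Ω → H)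
    (A : Set Ω) (j : ℕ) (t : ℝ) : Ω → ℝ :=
  A.indicator fun ω => √(mu j) * modeBM e mu W j (projIcc 0 T hT t) ω

variable (hT : 0 ≤ T) {e : HilbertBasis ℕ ℝ H} {mu : ℕ → ℝ} {W : Icc (0 : ℝ) T → Ω → H}
  {A : Set Ω}

lemma continuous_modeNoise (hA : ∀ ω ∈ A, Continuous fun t => W t ω) (j : ℕ) (ω : Ω) :
    Continuous fun t => modeNoise hT e mu W A j t ω := by
  by_cases h : ω ∈ A
  · simp only [modeNoise, indicator_of_mem h, modeBM]
    have := (hA ω h).comp (continuous_projIcc (h := hT))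
    exact continuous_const.mul ((this.inner continuous_const).div_const _)
  · simp only [modeNoise, indicator_of_notMem h]
    exact continuous_const

/-- Equality holds on `A` when `mu j > 0`. Off `A`, or when `√(mu j) = 0`, the left side is zero
while the right side need not vanish on every path. -/
lemma modeNoise_sub_sq_le (j : ℕ) (τ t : ℝ) (ω : Ω) :
    (modeNoise hT e mu W A j τ ω - modeNoise hT e mu W A j t ω) ^ 2
      ≤ ⟪W (projIcc 0 T hT t) ω - W (projIcc 0 T hT τ) ω, e j⟫ ^ 2 := by
  by_cases h : ω ∈ A
  · simp only [modeNoise, indicator_of_mem h, modeBM]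
    rcases eq_or_ne (√(mu j)) 0 with h0 | h0
    · simpa only [h0, zero_mul, sub_zero, zero_pow two_ne_zero] using sq_nonneg _
    · rw [mul_div_cancel₀ _ h0, mul_div_cancel₀ _ h0, inner_sub_left]
      exact le_of_eq (by ring)
  · simpa only [modeNoise, indicator_of_notMem h, sub_zero, zero_pow two_ne_zero] using sq_nonneg _

/-- The representation is known for positive exponents only, but these form a neighbourhood of `s`,
and the germ determines the iterated derivatives. -/
lemma modeDeriv_eq_modeRep {l c : ℝ} (hl : 0 < l) {y : ℕ → ℝ → ℝ → Ω → ℝ} {g : ℝ → ℝ}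
    (hg : Continuous g) {j : ℕ} {t : ℝ} {ω : Ω}
    (h : ∀ s : ℝ, 0 < s → y j s t ω = modeRep l c g 0 s t) {k : ℕ} (hk : k ≤ 2) {s : ℝ}
    (hs : 0 < s) : modeDeriv y k j s t ω = modeRep l c g k s t := by
  have : (fun r => y j r t ω) =ᶠ[𝓝 s] fun r => modeRep l c g 0 r t :=
    (Ioi_mem_nhds hs : Ioi 0 ∈ 𝓝 s) |> fun hm => by filter_upwards [hm] with r hr using h r hr
  rw [modeDeriv, this.iteratedDeriv_eq, iteratedDeriv_modeRep hl c hg hk]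

variable [MeasurableSpace Ω] {P : Measure Ω}

lemma lintegral_sq_inner_sub {Q : H →L[ℝ] H} {W : Icc (0 : ℝ) T → Ω → H}
    (hW : IsQWiener P T Q W) {s t : Icc (0 : ℝ) T} (hst : s ≤ t) (h : H) :
    ∫⁻ ω, ENNReal.ofReal (⟪W t ω - W s ω, h⟫ ^ 2) ∂P
      = ENNReal.ofReal (((t : ℝ) - s) * ⟪Q h, h⟫) := by
  have hm : Measurable fun ω => ⟪W t ω - W s ω, h⟫ :=
    (((hW.stronglyMeasurable t).sub (hW.stronglyMeasurable s)).inner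
      stronglyMeasurable_const).measurable
  rw [← lintegral_map (f := fun x => ENNReal.ofReal (x ^ 2)) (by fun_prop) hm,
    hW.gaussian_increments s t hst h, lintegral_sq_gaussianReal]
  rfl

lemma measurable_modeNoise (hA : MeasurableSet A) (hW : ∀ t, StronglyMeasurable (W t)) (j : ℕ)
    (t : ℝ) : Measurable (modeNoise hT e mu W A j t) :=
  Measurable.indicator ((((hW _).inner stronglyMeasurable_const).measurable.div_const _).const_mul _)
    hA

lemma lintegral_modeNoise_sub_sq_le {Q : H →L[ℝ] H} (hQ : IsCovariance Q e mu)
    (hW : IsQWiener P T Q W) (j : ℕ) {τ t : ℝ} (h0 : 0 ≤ τ) (h1 : τ ≤ t) (h2 : t ≤ T) :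
    ∫⁻ ω, ENNReal.ofReal ((modeNoise hT e mu W A j τ ω - modeNoise hT e mu W A j t ω) ^ 2) ∂P
      ≤ ENNReal.ofReal (mu j * (t - τ)) := by
  calc _ ≤ ∫⁻ ω, ENNReal.ofReal
        (⟪W (projIcc 0 T hT t) ω - W (projIcc 0 T hT τ) ω, e j⟫ ^ 2) ∂P :=
        lintegral_mono fun ω => ENNReal.ofReal_le_ofReal (modeNoise_sub_sq_le hT j τ t ω)
    _ = _ := by
        rw [lintegral_sq_inner_sub hW (monotone_projIcc hT h1), hQ.inner_eq,
          projIcc_of_mem hT ⟨h0, h1.trans h2⟩, projIcc_of_mem hT ⟨h0.trans h1, h2⟩, mul_comm]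

lemma lintegral_modeNoise_sq_le {Q : H →L[ℝ] H} (hQ : IsCovariance Q e mu)
    (hW : IsQWiener P T Q W) (j : ℕ) {t : ℝ} (ht : t ∈ Icc 0 T) :
    ∫⁻ ω, ENNReal.ofReal (modeNoise hT e mu W A j t ω ^ 2) ∂P ≤ ENNReal.ofReal (mu j * t) := by
  have h := lintegral_modeNoise_sub_sq_le hT (A := A) hQ hW j le_rfl ht.1 ht.2
  rw [sub_zero] at h
  refine (le_of_eq (lintegral_congr_ae ?_)).trans h
  filter_upwards [hW.zero (projIcc 0 T hT 0) (by simp)] with ω hω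
  have : modeNoise hT e mu W A j 0 ω = 0 := by
    simp only [modeNoise, modeBM, indicator, hω, inner_zero_left, zero_div, mul_zero, ite_self]
  rw [this, zero_sub, neg_sq]

/-- The modes are represented by `modeRep`, on one event for all indices, exponents and times. -/
lemma ae_eq_modeRep {lam : ℕ → ℝ} {y₀ : H} {y : ℕ → ℝ → ℝ → Ω → ℝ}
    (hy : IsModeSolution P T e lam mu W y₀ y) (hA : ∀ ω ∈ A, Continuous fun t => W t ω)
    (hAP : ∀ᵐ ω ∂P, ω ∈ A) :
    ∀ᵐ ω ∂P, ∀ j, ∀ s : ℝ, 0 < s → ∀ t ∈ Icc 0 T,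
      y j s t ω = modeRep (lam j) ⟪y₀, e j⟫ (fun t => modeNoise hT e mu W A j t ω) 0 s t := by
  filter_upwards [hy, hAP] with ω hω hωA j s hs t ht
  obtain ⟨hc, heq⟩ := hω j s hs
  refine eq_modeRep_of_linear_integral_equation (continuous_modeNoise hT hA j ω) hc
    (fun t ht => ?_) ht
  rw [heq ⟨t, ht⟩]
  simp only [modeNoise, indicator_of_mem hωA, projIcc_of_mem hT ht]

/-- A continuous and measurable version of the noise, which represents the modes. -/
lemma exists_modeNoise [CompleteSpace H] (hT : 0 ≤ T) {Q : H →L[ℝ] H} (hQ : IsCovariance Q e mu)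
    (hW : IsQWiener P T Q W) {lam : ℕ → ℝ} {y₀ : H} {y : ℕ → ℝ → ℝ → Ω → ℝ}
    (hy : IsModeSolution P T e lam mu W y₀ y) :
    ∃ G : ℕ → ℝ → Ω → ℝ, (∀ j ω, Continuous fun t => G j t ω) ∧ (∀ j t, Measurable (G j t)) ∧
      (∀ j, ∀ t ∈ Icc 0 T, ∫⁻ ω, ENNReal.ofReal (G j t ω ^ 2) ∂P ≤ ENNReal.ofReal (mu j * t)) ∧
      (∀ j τ t, 0 ≤ τ → τ ≤ t → t ≤ T →
        ∫⁻ ω, ENNReal.ofReal ((G j τ ω - G j t ω) ^ 2) ∂P ≤ ENNReal.ofReal (mu j * (t - τ))) ∧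
      ∀ᵐ ω ∂P, ∀ j, ∀ s : ℝ, 0 < s → ∀ t ∈ Icc 0 T,
        y j s t ω = modeRep (lam j) ⟪y₀, e j⟫ (fun t => G j t ω) 0 s t := by
  -- A measurable event of full probability with continuous paths; cutting off outside it keeps the
  -- noise measurable and makes every path continuous.
  obtain ⟨A, hAP, hAm, hA⟩ := hW.continuous_paths.exists_measurable_mem
  exact ⟨modeNoise hT e mu W A, continuous_modeNoise hT hA,
    measurable_modeNoise hT hAm hW.stronglyMeasurable,
    fun j t ht => lintegral_modeNoise_sq_le hT hQ hW j ht,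
    fun j τ t h0 h1 h2 => lintegral_modeNoise_sub_sq_le hT hQ hW j h0 h1 h2,
    ae_eq_modeRep hT hy hA hAP⟩

end Modes

/-! ### Random series on the cylinder -/

section Series

variable {E : Type*} [NormedAddCommGroup E] [InnerProductSpace ℝ E] [FiniteDimensional ℝ E]
  [MeasurableSpace E] [BorelSpace E]

instance (D : Set E) (T : ℝ) : SFinite (cylMeasure D T) := by
  unfold cylMeasure; infer_instance

/-- Convergence of a random series `∑ j, Φ j ω t * e j x` in `L²(Ω, L²(D × [0, T]))`, and almost
surely in `L²(D × [0, T])`. -/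
lemma exists_hasSum_cylinder {D : Set E} {T : ℝ} (e : HilbertBasis ℕ ℝ (L2D D)) {Ω : Type*}
    [MeasurableSpace Ω] {P : Measure Ω} {Φ : ℕ → Ω → ℝ → ℝ} (hΦc : ∀ j ω, Continuous (Φ j ω))
    (hΦm : ∀ j, Measurable (Φ j).uncurry) {b : ℕ → ℝ} (hb0 : ∀ j, 0 ≤ b j) (hb : Summable b)
    (hΦb : ∀ j, ∫⁻ ω, (∫⁻ t in Icc 0 T, ENNReal.ofReal (Φ j ω t ^ 2)) ∂P ≤ ENNReal.ofReal (b j)) :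
    ∃ (u : ℕ → Lp (L2DT D T) 2 P) (U : Lp (L2DT D T) 2 P),
      (∀ j, ∀ᵐ ω ∂P, (u j ω : E × ℝ → ℝ) =ᵐ[cylMeasure D T]
        fun p => Φ j ω p.2 * (e j : E → ℝ) p.1) ∧
      HasSum u U ∧ (∀ᵐ ω ∂P, HasSum (fun j => u j ω) (U ω)) ∧
      ∀ᵐ ω ∂P, ENNReal.ofReal (‖U ω‖ ^ 2)
        = ∑' j, ∫⁻ t in Icc (0 : ℝ) T, ENNReal.ofReal (Φ j ω t ^ 2) := by
  -- A version of the terms defined for every `ω`, so that norms and orthogonality hold pathwise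
  -- without exceptional sets.
  let v : ℕ → Ω → L2DT D T := fun j ω => (memLp_cylMeasure_mul D T (hΦc j ω) (e j)).toLp _
  have hvm : ∀ j, StronglyMeasurable (v j) := fun j =>
    stronglyMeasurable_toLp (F := fun ω (p : E × ℝ) => Φ j ω p.2 * e j p.1)
      (((hΦm j).comp (measurable_fst.prodMk (measurable_snd.comp measurable_snd))).mul
        ((Lp.stronglyMeasurable (e j)).measurable.comp (measurable_fst.comp measurable_snd))) _
  have hvn : ∀ j ω, ENNReal.ofReal (‖v j ω‖ ^ 2)
      = ∫⁻ t in Icc 0 T, ENNReal.ofReal (Φ j ω t ^ 2) := fun j ω =>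
    ofReal_norm_sq_toLp_mul D T (hΦc j ω) (e.orthonormal.1 j)
  have hve : ∀ j ω, v j ω =ᵐ[cylMeasure D T] fun p => Φ j ω p.2 * (e j : E → ℝ) p.1 := fun j ω =>
    (memLp_cylMeasure_mul D T (hΦc j ω) (e j)).coeFn_toLp
  have hvo : ∀ ω i j, i ≠ j → ⟪v i ω, v j ω⟫ = 0 := fun ω i j hij =>
    inner_toLp_mul_eq_zero D T (hΦc i ω) (hΦc j ω) (e.orthonormal.2 hij)
  clear_value v
  have hbound : ∀ j, ∫⁻ ω, ‖v j ω‖ₑ ^ 2 ∂P ≤ ENNReal.ofReal (b j) := by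
    intro j
    refine (le_of_eq (lintegral_congr fun ω => ?_)).trans (hΦb j)
    rw [← hvn, ENNReal.ofReal_pow (norm_nonneg _), ofReal_norm]
  have hvL : ∀ j, MemLp (v j) 2 P := fun j =>
    memLp_two_of_lintegral_lt_top (hvm j).aestronglyMeasurable
      ((hbound j).trans_lt ENNReal.ofReal_lt_top)
  obtain ⟨u, hu⟩ : ∃ u : ℕ → Lp (L2DT D T) 2 P, ∀ j, u j =ᵐ[P] v j :=
    ⟨fun j => (hvL j).toLp (v j), fun j => (hvL j).coeFn_toLp⟩
  have huv : ∀ᵐ ω ∂P, ∀ j, u j ω = v j ω := ae_all_iff.2 hu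
  have hsum : Summable fun j => ‖u j‖ ^ 2 := by
    refine Summable.of_nonneg_of_le (fun j => sq_nonneg _) (fun j => ?_) hb
    rw [← ENNReal.ofReal_le_ofReal_iff (hb0 j), ← lintegral_enorm_sq_Lp]
    refine (le_of_eq (lintegral_congr_ae ?_)).trans (hbound j)
    filter_upwards [hu j] with ω hω
    rw [hω]
  obtain ⟨U, hU, hUω⟩ := exists_hasSum_Lp_of_orthogonal
    (huv.mono fun ω hω i j hij => by rw [hω, hω]; exact hvo ω i j hij) hsum
  refine ⟨u, U, fun j => ?_, hU, hUω, ?_⟩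
  · filter_upwards [hu j] with ω hω
    rw [hω]
    exact hve j ω
  · filter_upwards [huv, hUω] with ω hω hS
    simp only [hω] at hS
    have h := hasSum_norm_sq_of_pairwise_orthogonal (hvo ω) hS
    simp_rw [← hvn]
    rw [← h.tsum_eq, ENNReal.ofReal_tsum_of_nonneg (fun j => sq_nonneg _) h.summable]

end Series

end FractionalSPDE

end

/-! ### The main theorem -/

open FractionalSPDE in
theorem mainTheorem5
    {E : Type*} [NormedAddCommGroup E] [InnerProductSpace ℝ E] [FiniteDimensional ℝ E]
    [MeasurableSpace E] [BorelSpace E]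
    (D : Set E) (hD_open : IsOpen D) (hD_bdd : Bornology.IsBounded D)
    (T : ℝ) (hT : 0 < T)
    (L : L2D D →ₗ.[ℝ] L2D D) (hL : IsDiffusionOperator L)
    (e : HilbertBasis ℕ ℝ (L2D D)) (lam : ℕ → ℝ) (he : IsEigenbasis L e lam)
    (Q : L2D D →L[ℝ] L2D D) (mu : ℕ → ℝ) (hQ : IsCovariance Q e mu)
    {Ω : Type*} [MeasurableSpace Ω] (P : Measure Ω) [IsProbabilityMeasure P]
    (W : Icc (0 : ℝ) T → Ω → L2D D) (hW : IsQWiener P T Q W)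
    (y₀ : L2D D)
    (y : ℕ → ℝ → ℝ → Ω → ℝ) (hy : IsModeSolution P T e lam mu W y₀ y) :
    -- the modes are almost surely twice continuously differentiable in the exponent
    (∀ᵐ ω ∂P, ∀ j, ∀ t ∈ Icc (0 : ℝ) T, ContDiffOn ℝ 2 (fun s => y j s t ω) (Ioi 0)) ∧
    -- first (`k = 1`) and second (`k = 2`) derivative of the solution at an exponent `s > 0`
    ∀ s : ℝ, 0 < s → ∀ k : ℕ, (k = 1 ∨ k = 2) →
      ∃ (u : ℕ → Lp (L2DT D T) 2 P) (U : Lp (L2DT D T) 2 P),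
        -- `u j` is the term `∂_s^k y_j(s, ·) e_j` of the series
        (∀ j, ∀ᵐ ω ∂P, (u j ω : E × ℝ → ℝ) =ᵐ[cylMeasure D T]
          fun p => modeDeriv y k j s p.2 ω * (e j : E → ℝ) p.1) ∧
        -- the series converges in `L²(Ω, L²(D × [0, T]))`, and `U` is its sum
        HasSum u U ∧
        -- almost surely, it converges in `L²(D × [0, T])` to `U ω`
        (∀ᵐ ω ∂P, HasSum (fun j => u j ω) (U ω)) ∧
        -- almost surely, the squared `L²(D × [0, T])`-norm of the sum is finite
        (∀ᵐ ω ∂P,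
          ENNReal.ofReal (‖U ω‖ ^ 2) =
            ∑' j, ∫⁻ t in Icc (0 : ℝ) T, ENNReal.ofReal (modeDeriv y k j s t ω ^ 2) ∧
          ∑' j, ∫⁻ t in Icc (0 : ℝ) T, ENNReal.ofReal (modeDeriv y k j s t ω ^ 2) < ∞) := by
  obtain ⟨l₀, hl₀, hlam⟩ := exists_pos_le_eigenvalue hL he
  have hl : ∀ j, 0 < lam j := fun j => hl₀.trans_le (hlam j)
  obtain ⟨G, hGc, hGm, hG0, hGinc, hrep⟩ := exists_modeNoise hT.le hQ hW hy
  refine ⟨?_, fun s hs k hk => ?_⟩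
  · filter_upwards [hrep] with ω hω j t ht
    exact (contDiff_modeRep (hl j) ⟪y₀, e j⟫ (hGc j ω) t).contDiffOn.congr
      fun s hs => hω j s hs t ht
  have hk2 : k ≤ 2 := by omega
  let Φ : ℕ → Ω → ℝ → ℝ := fun j ω t => modeRep (lam j) ⟪y₀, e j⟫ (fun t => G j t ω) k s t
  have hderiv : ∀ᵐ ω ∂P, ∀ j, ∀ t ∈ Icc 0 T, modeDeriv y k j s t ω = Φ j ω t := by
    filter_upwards [hrep] with ω hω j t ht
    exact modeDeriv_eq_modeRep (hl j) (hGc j ω) (fun r hr => hω j r hr t ht) hk2 hs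
  obtain ⟨C, hC0, hC⟩ := exists_log_pow_div_rpow_le hl₀ hs k
  have hmu := hQ.nonneg
  -- The bound `b j` is summable by Bessel's inequality for `y₀` and the finite trace; `C` has
  -- absorbed the logarithms and `lam j ^ s`.
  obtain ⟨u, U, hu, hU, hUω, hUn⟩ := exists_hasSum_cylinder (T := T) (P := P) e (Φ := Φ)
    (b := fun j => 256 * C * (⟪y₀, e j⟫ ^ 2 + 17 * mu j * T))
    (fun j ω => continuous_modeRep (hl j) (hGc j ω) k)
    (fun j => (measurable_modeRep (hl j) (hGc j) (hGm j) k).comp measurable_swap)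
    (fun j => by have := hmu j; positivity)
    (by
      refine Summable.mul_left _ (Summable.add ?_ ((hQ.summable.mul_left 17).mul_right T))
      simpa [real_inner_comm] using e.orthonormal.inner_products_summable y₀)
    (fun j => by
      refine (lintegral_lintegral_modeRep_sq_le (hl j) hT.le (hmu j) (hGc j) (hGm j)
        (hG0 j) (hGinc j) k).trans
        (ENNReal.ofReal_le_ofReal ?_)
      have := hmu j
      rw [mul_div_assoc]
      gcongr
      exact hC _ (hlam j))
  clear_value Φ
  refine ⟨u, U, fun j => ?_, hU, hUω, ?_⟩
  · have hT' : ∀ᵐ p ∂(cylMeasure D T), p.2 ∈ Icc 0 T :=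
      Measure.quasiMeasurePreserving_snd.ae (ae_restrict_mem measurableSet_Icc)
    filter_upwards [hu j, hderiv] with ω hω hd
    filter_upwards [hω, hT'] with p hp hpT
    rw [hd j _ hpT, hp]
  · filter_upwards [hderiv, hUn] with ω hω hn
    have heq : ENNReal.ofReal (‖U ω‖ ^ 2) =
        ∑' j, ∫⁻ t in Icc (0 : ℝ) T, ENNReal.ofReal (modeDeriv y k j s t ω ^ 2) := by
      rw [hn]
      exact tsum_congr fun j => setLIntegral_congr_fun measurableSet_Icc fun t ht => by
        simp only [hω j t ht]
    exact ⟨heq, heq ▸ ENNReal.ofReal_lt_top⟩
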